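/- Let $A=\{0,1\}$. An infinite word $\mathbf w=w_0w_1w_2\cdots$ over $A$ is \emph{Sturmian} if for every $n\ge 0$ it has exactly $n+1$ distinct factors (blocks of consecutive letters) of length $n$. For $0<\alpha<1$, let $\mathbf s_{\alpha,0}$ (resp. $\mathbf s'_{\alpha,0}$) be the infinite word whose $n$-th letter ($n\ge 0$) is $0$ if $\{n\alpha\}<1-\alpha$ (resp. if $0<\{n\alpha\}\le 1-\alpha$) and $1$ otherwise, where $\{\cdot\}$ denotes the fractional part. A \emph{lower} (resp. \emph{upper}) \emph{Christoffel word} is either one of the single letters $0$, $1$, or the shortest word $v$ such that $\mathbf s_{\alpha,0}=vvv\cdots$ (resp. $\mathbf s'_{\alpha,0}=vvv\cdots$) for some rational $\alpha\in(0,1)$; a \emph{Christoffel word} is a lower or an upper Christoffel word. For a finite word $v$, let $\tilde v$ be its reversal. A \emph{reversible Christoffel (RC) factorization} of a Sturmian word $\mathbf w$ is an infinite sequence $(x_k)_{k\ge 1}$ of Christoffel words such that $\mathbf w=x_1x_2\cdots x_n\cdots$ and the infinite word $\widetilde{x_1}\widetilde{x_2}\cdots\widetilde{x_n}\cdots$ is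 also Sturmian. \textbf{Proposition.} Let $\mathbf w$ be a Sturmian word and let $(x_k)_{k\ge 1}$ be any RC factorization of $\mathbf w$. Then either all the terms $x_k$, $k\ge 1$, are upper Christoffel words, or all of them are lower Christoffel words. (Single letters count as both, so both alternatives hold when every $x_k$ is a letter.) -/

import Mathlib

/-- Finite words over the alphabet `A = {0, 1}`. -/
abbrev FinWord : Type := List (Fin 2)

/-- (Right) infinite words over the alphabet `A = {0, 1}`. -/
abbrev InfWord : Type := ℕ → Fin 2

namespace InfWord

/-- The factor of length `n` of `w` occurring at position `i`. -/
def factorAt (w : InfWord) (i n : ℕ) : FinWord :=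
  (List.range n).map fun j => w (i + j)

/-- The set of factors of length `n` of `w`. -/
def factors (w : InfWord) (n : ℕ) : Set FinWord :=
  {u | ∃ i, u = w.factorAt i n}

/-- A word is Sturmian if it has exactly `n + 1` distinct factors of each length `n ≥ 0`. -/
def IsSturmian (w : InfWord) : Prop :=
  ∀ n : ℕ, (w.factors n).ncard = n + 1

/-- `w = x 0 · x 1 · x 2 ⋯`: all the words `x k` are nonempty, and each finite product
`x 0 ⋯ x (n - 1)` is a prefix of `w`. -/
def IsProduct (w : InfWord) (x : ℕ → FinWord) : Prop :=
  (∀ k, x k ≠ []) ∧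
    ∀ n, ((List.range n).map x).flatten = w.factorAt 0 ((List.range n).map x).flatten.length

/-- `w = v ^ ω = v v v ⋯`. The word `v` is necessarily nonempty, as `[][i]? = none`. -/
def IsOmegaPower (w : InfWord) (v : FinWord) : Prop :=
  ∀ n : ℕ, v[n % v.length]? = some (w n)

/-- `v` is the shortest word with `w = v ^ ω`. -/
def IsShortestPeriod (w : InfWord) (v : FinWord) : Prop :=
  w.IsOmegaPower v ∧ ∀ v' : FinWord, w.IsOmegaPower v' → v.length ≤ v'.length

/-- The lower mechanical word of slope `α` and intercept `ρ`. -/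
noncomputable def lowerMechanical (α ρ : ℝ) : InfWord := fun n =>
  if Int.fract (n * α + ρ) < 1 - α then 0 else 1

open Classical in
/-- The upper mechanical word of slope `α` and intercept `ρ`. -/
noncomputable def upperMechanical (α ρ : ℝ) : InfWord := fun n =>
  if 0 < Int.fract (n * α + ρ) ∧ Int.fract (n * α + ρ) ≤ 1 - α then 0 else 1

end InfWord

namespace FinWord

/-- Lower Christoffel words: the two letters (the degenerate slopes `0` and `1`), and the shortest
periods of the lower mechanical words of intercept `0` and rational slope in `(0, 1)`. -/
def IsLowerChristoffel (v : FinWord) : Prop :=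
  (∃ a : Fin 2, v = [a]) ∨
    ∃ α : ℚ, 0 < α ∧ α < 1 ∧ (InfWord.lowerMechanical (α : ℝ) 0).IsShortestPeriod v

/-- Upper Christoffel words: the two letters (the degenerate slopes `0` and `1`), and the shortest
periods of the upper mechanical words of intercept `0` and rational slope in `(0, 1)`. -/
def IsUpperChristoffel (v : FinWord) : Prop :=
  (∃ a : Fin 2, v = [a]) ∨
    ∃ α : ℚ, 0 < α ∧ α < 1 ∧ (InfWord.upperMechanical (α : ℝ) 0).IsShortestPeriod v

/-- Christoffel words, lower or upper. -/
def IsChristoffel (v : FinWord) : Prop :=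
  IsLowerChristoffel v ∨ IsUpperChristoffel v

end FinWord

/-- The sequence `x` of Christoffel words is a reversible Christoffel factorization of `w`:
`w = x 0 · x 1 ⋯`, and the infinite product of the reversals of the `x k` is Sturmian. -/
def InfWord.IsRCFactorization (w : InfWord) (x : ℕ → FinWord) : Prop :=
  (∀ k, FinWord.IsChristoffel (x k)) ∧ w.IsProduct x ∧
    ∃ w' : InfWord, w'.IsProduct (fun k => (x k).reverse) ∧ w'.IsSturmian

namespace InfWord

/-! Reversing a block changes neither its length nor its number of ones, so the prefixes of `w` and
of the reversed product `w'` have equal heights (numbers of ones) at every block boundary. A block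
that is lower but not upper starts with 0 and ends with 1, so one letter into it `w'` is one higher
than `w`; an upper, non-lower block gives the opposite. If both occur, some window carries two more
ones in one word than in the other.

This is impossible for Sturmian words. Both are balanced (`IsSturmian.isBalanced`), so such a
discrepancy, together with the recurring equality of heights, makes one word eventually periodic
(`IsBalanced.isEventuallyPeriodic`), against `IsSturmian.not_isEventuallyPeriodic`. -/

/-- The number of letters `1` in the prefix of length `n` of `w`. -/
def ones (w : InfWord) (n : ℕ) : ℤ :=
  ∑ i ∈ Finset.range n, ((w i).val : ℤ)

theorem ones_zero (w : InfWord) : w.ones 0 = 0 := by simp [ones]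

theorem ones_succ (w : InfWord) (n : ℕ) : w.ones (n + 1) = w.ones n + ((w n).val : ℤ) := by
  simp [ones, Finset.sum_range_succ]

/-- The factors of length `n` at the positions `i` and `j` are equal. -/
def AgreeAt (w : InfWord) (i j n : ℕ) : Prop :=
  ∀ k < n, w (i + k) = w (j + k)

/-- The factor of length `n` at position `i` is right special. -/
def IsRightSpecialAt (w : InfWord) (i n : ℕ) : Prop :=
  ∃ j, w.AgreeAt i j n ∧ w (i + n) ≠ w (j + n)

/-- Two factors of the same length have numbers of ones that differ by at most one. -/
def IsBalanced (w : InfWord) : Prop :=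
  ∀ i j n, w.ones (i + n) - w.ones i ≤ w.ones (j + n) - w.ones j + 1

/-- `w` is eventually periodic. -/
def IsEventuallyPeriodic (w : InfWord) : Prop :=
  ∃ a p, 0 < p ∧ ∀ i, a ≤ i → w i = w (i + p)

theorem factorAt_eq_iff {w : InfWord} {i j n : ℕ} :
    w.factorAt i n = w.factorAt j n ↔ w.AgreeAt i j n := by
  simp [factorAt, AgreeAt]

theorem finite_factors (w : InfWord) (n : ℕ) : (w.factors n).Finite := by
  refine (List.finite_length_eq (Fin 2) n).subset ?_
  rintro u ⟨i, rfl⟩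
  simp [factorAt]

theorem AgreeAt.symm {w : InfWord} {i j n : ℕ} (h : w.AgreeAt i j n) : w.AgreeAt j i n :=
  fun k hk => (h k hk).symm

theorem AgreeAt.trans {w : InfWord} {i j l n : ℕ} (h : w.AgreeAt i j n) (h' : w.AgreeAt j l n) :
    w.AgreeAt i l n :=
  fun k hk => (h k hk).trans (h' k hk)

theorem AgreeAt.mono {w : InfWord} {i j m n : ℕ} (h : w.AgreeAt i j n) (hm : m ≤ n) :
    w.AgreeAt i j m :=
  fun k hk => h k (hk.trans_le hm)

theorem AgreeAt.tail {w : InfWord} {i j n : ℕ} (h : w.AgreeAt i j (n + 1)) :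
    w.AgreeAt (i + 1) (j + 1) n := fun k hk => by
  have := h (k + 1) (by omega)
  rwa [show i + 1 + k = i + (k + 1) by ring, show j + 1 + k = j + (k + 1) by ring]

theorem AgreeAt.snoc {w : InfWord} {i j n : ℕ} (h : w.AgreeAt i j n) (h' : w (i + n) = w (j + n)) :
    w.AgreeAt i j (n + 1) := fun k hk => by
  rcases Nat.lt_succ_iff_lt_or_eq.1 hk with hk | rfl
  exacts [h k hk, h']

theorem IsRightSpecialAt.tail {w : InfWord} {i n : ℕ} (h : w.IsRightSpecialAt i (n + 1)) :
    w.IsRightSpecialAt (i + 1) n := by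
  obtain ⟨j, hj, hne⟩ := h
  refine ⟨j + 1, hj.tail, ?_⟩
  rwa [show i + 1 + n = i + (n + 1) by ring, show j + 1 + n = j + (n + 1) by ring]

theorem IsRightSpecialAt.congr {w : InfWord} {i j n : ℕ} (h : w.IsRightSpecialAt i n)
    (hij : w.AgreeAt i j n) : w.IsRightSpecialAt j n := by
  obtain ⟨l, hl, hne⟩ := h
  by_cases e : w (j + n) = w (l + n)
  · exact ⟨i, hij.symm, fun e' => hne (e'.symm.trans e)⟩
  · exact ⟨l, hij.symm.trans hl, e⟩

/-! ### Aperiodicity and right special factors -/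

theorem IsSturmian.not_isEventuallyPeriodic {w : InfWord} (hw : w.IsSturmian) :
    ¬ w.IsEventuallyPeriodic := by
  rintro ⟨a, p, hp, h⟩
  have key : ∀ n i, ∃ j < a + p, w.AgreeAt i j n := by
    intro n i
    induction i using Nat.strong_induction_on with
    | _ i ih =>
      by_cases hi : i < a + p
      · exact ⟨i, hi, fun _ _ => rfl⟩
      · obtain ⟨j, hj, hij⟩ := ih (i - p) (by omega)
        refine ⟨j, hj, AgreeAt.trans (fun k _ => ?_) hij⟩
        rw [h (i - p + k) (by omega)]
        congr 1
        omega
  have hsub : w.factors (a + p) ⊆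
      ((Finset.range (a + p)).image fun i => w.factorAt i (a + p) : Finset FinWord) := by
    rintro u ⟨i, rfl⟩
    obtain ⟨j, hj, hij⟩ := key (a + p) i
    simp only [Finset.coe_image, Finset.coe_range, Set.mem_image, Set.mem_Iio]
    exact ⟨j, hj, factorAt_eq_iff.2 hij.symm⟩
  have h1 := Set.ncard_le_ncard hsub (Finset.finite_toSet _)
  rw [hw, Set.ncard_coe_finset] at h1
  have h2 := Finset.card_image_le (s := Finset.range (a + p)) (f := fun i => w.factorAt i (a + p))
  rw [Finset.card_range] at h2
  omega

theorem IsSturmian.exists_isRightSpecialAt {w : InfWord} (hw : w.IsSturmian) (n : ℕ) :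
    ∃ i, w.IsRightSpecialAt i n := by
  by_contra! hno
  have hle : (w.factors (n + 1)).ncard ≤ (w.factors n).ncard := by
    refine Set.ncard_le_ncard_of_injOn (fun u => u.take n) ?_ ?_ (w.finite_factors n)
    · rintro _ ⟨i, rfl⟩
      exact ⟨i, by simp [factorAt, ← List.map_take, List.take_range]⟩
    · rintro _ ⟨i, rfl⟩ _ ⟨j, rfl⟩ hij
      have hij' : w.factorAt i n = w.factorAt j n := by
        simpa [factorAt, ← List.map_take, List.take_range] using hij
      rw [factorAt_eq_iff] at hij' ⊢
      refine hij'.snoc ?_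
      by_contra hne
      exact hno i ⟨j, hij', hne⟩
  rw [hw, hw] at hle
  omega

/-- Choose one right extension of each of the `n + 1` factors. Two different right special factors
would each add an extension, giving `n + 3 > n + 2` factors of length `n + 1`. -/
theorem IsSturmian.agreeAt_of_isRightSpecialAt {w : InfWord} (hw : w.IsSturmian) {i i' n : ℕ}
    (h : w.IsRightSpecialAt i n) (h' : w.IsRightSpecialAt i' n) : w.AgreeAt i i' n := by
  by_contra hne
  obtain ⟨j, hj, hjn⟩ := h
  obtain ⟨j', hj', hjn'⟩ := h'
  have hrep : ∀ u : FinWord, ∃ l, u ∈ w.factors n → u = w.factorAt l n := by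
    intro u
    by_cases hu : u ∈ w.factors n
    · obtain ⟨l, hl⟩ := hu
      exact ⟨l, fun _ => hl⟩
    · exact ⟨0, fun hu' => (hu hu').elim⟩
  choose g hg using hrep
  have hgl : ∀ l, w.AgreeAt l (g (w.factorAt l n)) n := fun l =>
    factorAt_eq_iff.1 (hg _ ⟨l, rfl⟩)
  -- each right special factor has an extension that is not the chosen one
  have hext : ∀ a b, w.AgreeAt a b n → w (a + n) ≠ w (b + n) →
      ∃ e, w.AgreeAt a e n ∧ w (e + n) ≠ w (g (w.factorAt a n) + n) := by
    intro a b hab hn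
    by_cases e : w (a + n) = w (g (w.factorAt a n) + n)
    · exact ⟨b, hab, fun e' => hn (e.trans e'.symm)⟩
    · exact ⟨a, fun _ _ => rfl, e⟩
  obtain ⟨e, he, hen⟩ := hext i j hj hjn
  obtain ⟨e', he', hen'⟩ := hext i' j' hj' hjn'
  set G : Set FinWord := (fun u => w.factorAt (g u) (n + 1)) '' w.factors n with hG
  have hGfin : G.Finite := (w.finite_factors n).image _
  have hGcard : G.ncard = n + 1 := by
    rw [hG, Set.InjOn.ncard_image, hw]
    rintro u hu v hv huv
    rw [hg u hu, hg v hv]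
    exact factorAt_eq_iff.2 ((factorAt_eq_iff.1 huv).mono n.le_succ)
  have hnotG : ∀ a b, w.AgreeAt a b n → w (b + n) ≠ w (g (w.factorAt a n) + n) →
      w.factorAt b (n + 1) ∉ G := by
    rintro a b hab hn ⟨u, hu, hub⟩
    have h1 : w.AgreeAt (g u) b (n + 1) := factorAt_eq_iff.1 hub
    have h2 : u = w.factorAt a n :=
      (hg u hu).trans (factorAt_eq_iff.2 ((h1.mono n.le_succ).trans hab.symm))
    rw [← h2] at hn
    exact hn (h1 n n.lt_succ_self).symm
  have h1 := hnotG i e he hen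
  have h2 := hnotG i' e' he' hen'
  have h3 : w.factorAt e (n + 1) ≠ w.factorAt e' (n + 1) := fun hee =>
    hne (he.trans (((factorAt_eq_iff.1 hee).mono n.le_succ).trans he'.symm))
  have hsub : insert (w.factorAt e (n + 1)) (insert (w.factorAt e' (n + 1)) G) ⊆
      w.factors (n + 1) := by
    intro u hu
    rcases hu with rfl | rfl | ⟨v, -, rfl⟩
    exacts [⟨_, rfl⟩, ⟨_, rfl⟩, ⟨_, rfl⟩]
  have hcard := Set.ncard_le_ncard hsub (w.finite_factors _)
  rw [hw, Set.ncard_insert_of_notMem (by simp [h3, h1]) (hGfin.insert _),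
    Set.ncard_insert_of_notMem h2 hGfin, hGcard] at hcard
  omega

/-- A factor that is not right special determines the next letter, so the stretch from `a` to `b`
repeats forever. -/
theorem isEventuallyPeriodic_of_agreeAt {w : InfWord} {a b n : ℕ} (hab : a < b)
    (hn : 0 < n) (h : w.AgreeAt a b n) (hs : ∀ i, a ≤ i → i < b → ¬ w.IsRightSpecialAt i n) :
    w.IsEventuallyPeriodic := by
  have key : ∀ t, w.AgreeAt (a + t) (b + t) n ∧ ¬ w.IsRightSpecialAt (a + t) n := by
    intro t
    induction t using Nat.strong_induction_on with
    | _ t ih =>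
      have h1 : w.AgreeAt (a + t) (b + t) n := by
        rcases t with _ | t
        · exact h
        · obtain ⟨h1, h2⟩ := ih t t.lt_succ_self
          refine AgreeAt.tail (h1.snoc ?_)
          by_contra hne
          exact h2 ⟨_, h1, hne⟩
      refine ⟨h1, ?_⟩
      by_cases ht : a + t < b
      · exact hs _ (by omega) ht
      · obtain ⟨h3, h4⟩ := ih (t - (b - a)) (by omega)
        rw [show b + (t - (b - a)) = a + t by omega] at h3
        exact fun h5 => h4 (h5.congr h3.symm)
  refine ⟨a, b - a, by omega, fun i hi => ?_⟩
  have := (key (i - a)).1 0 hn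
  rwa [show a + (i - a) + 0 = i by omega, show b + (i - a) + 0 = i + (b - a) by omega] at this

/-- Only `n` factors of length `n` are not right special, so two of these `n + 1` consecutive
positions carry the same one. -/
theorem IsSturmian.isEventuallyPeriodic_of_not_isRightSpecialAt {w : InfWord} (hw : w.IsSturmian)
    {q n : ℕ} (hn : 0 < n) (h : ∀ t ≤ n, ¬ w.IsRightSpecialAt (q + t) n) :
    w.IsEventuallyPeriodic := by
  obtain ⟨s, hs⟩ := hw.exists_isRightSpecialAt n
  have hfin : (w.factors n \ {w.factorAt s n}).Finite := (w.finite_factors n).sdiff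
  have hcard : hfin.toFinset.card = n := by
    rw [← Set.ncard_eq_toFinset_card _ hfin, Set.ncard_sdiff_singleton_of_mem
      (show w.factorAt s n ∈ w.factors n from ⟨s, rfl⟩), hw]
    rfl
  obtain ⟨a, ha, b, hb, hab, hfab⟩ := Finset.exists_ne_map_eq_of_card_lt_of_maps_to
    (s := Finset.range (n + 1)) (t := hfin.toFinset) (f := fun t => w.factorAt (q + t) n)
    (by simp [hcard]) (by
      intro t ht
      simp only [Finset.coe_range, Set.mem_Iio] at ht
      simp only [Set.Finite.coe_toFinset, Set.mem_sdiff, Set.mem_singleton_iff]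
      exact ⟨⟨_, rfl⟩, fun e => h t (by omega) (hs.congr (factorAt_eq_iff.1 e.symm))⟩)
  rw [Finset.mem_range] at ha hb
  have hagree := factorAt_eq_iff.1 hfab
  have hns : ∀ i, q ≤ i → i ≤ q + n → ¬ w.IsRightSpecialAt i n := fun i h1 h2 => by
    have := h (i - q) (by omega)
    rwa [show q + (i - q) = i by omega] at this
  rcases lt_or_gt_of_ne hab with hlt | hlt
  · exact isEventuallyPeriodic_of_agreeAt (by omega) hn hagree
      fun i h1 h2 => hns i (by omega) (by omega)
  · exact isEventuallyPeriodic_of_agreeAt (by omega) hn hagree.symm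
      fun i h1 h2 => hns i (by omega) (by omega)

/-! ### Balance -/

/-- If `a p a` is a factor with `p` a palindrome of length `m`, then the right special factor of
length `m + 1` is not `b p` with `b ≠ a`. -/
theorem IsSturmian.false_of_palindrome_of_ne {w : InfWord} (hw : w.IsSturmian) {i m s : ℕ}
    (hs : w.IsRightSpecialAt s (m + 1)) (hagree : w.AgreeAt (s + 1) (i + 1) m)
    (hpal : ∀ k < m, w (i + 1 + k) = w (i + (m - k))) (hend : w (i + m + 1) = w i)
    (hne : w s ≠ w i) : False := by
  refine hw.not_isEventuallyPeriodic
    (hw.isEventuallyPeriodic_of_not_isRightSpecialAt (q := i) m.succ_pos fun t ht hsp => ?_)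
  have hst := hw.agreeAt_of_isRightSpecialAt hsp hs
  have h0 : w (i + t) = w s := by simpa using hst 0 m.succ_pos
  rcases Nat.eq_zero_or_pos t with rfl | ht0
  · exact hne h0.symm
  rcases Nat.lt_or_ge m t with htm | htm
  · obtain rfl : t = m + 1 := by omega
    exact hne (h0.symm.trans hend)
  -- An occurrence of `b p` starting inside `p` covers the final `a`, whose mirror image in `p` is
  -- the starting letter `b`.
  have h1 := hst (m + 1 - t) (by omega)
  rw [show i + t + (m + 1 - t) = i + m + 1 by omega] at h1
  have h2 := hagree (m - t) (by omega)
  rw [show s + 1 + (m - t) = s + (m + 1 - t) by omega] at h2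
  have h3 := hpal (m - t) (by omega)
  rw [show m - (m - t) = t by omega] at h3
  exact hne ((h0.symm.trans h3.symm).trans (h2.symm.trans (h1.symm.trans hend)))

/-- A shortest imbalance has the form `1 p 1` against `0 p 0` with `p` a palindrome. Then `p` is
right special, so the right special factor one letter longer is `0 p` or `1 p`; each contradicts
`IsSturmian.false_of_palindrome_of_ne`, applied to `1 p 1` or `0 p 0` respectively. -/
theorem IsSturmian.isBalanced {w : InfWord} (hw : w.IsSturmian) : w.IsBalanced := by
  by_contra hb
  have hex : ∃ n i j, w.ones (j + n) - w.ones j + 1 < w.ones (i + n) - w.ones i := by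
    simp only [IsBalanced] at hb
    push Not at hb
    obtain ⟨i, j, n, h⟩ := hb
    exact ⟨n, i, j, h⟩
  classical
  obtain ⟨i, j, hij⟩ := Nat.find_spec hex
  have hmin : ∀ n < Nat.find hex, ∀ i j,
      w.ones (i + n) - w.ones i ≤ w.ones (j + n) - w.ones j + 1 := by
    intro n hn i j
    by_contra! hlt
    exact Nat.find_min hex hn ⟨i, j, hlt⟩
  generalize Nat.find hex = n at hij hmin
  have hle1 : ∀ k, ((w k).val : ℤ) ≤ 1 := fun k => by omega
  have hge0 : ∀ k, (0 : ℤ) ≤ ((w k).val : ℤ) := fun k => by omega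
  have hn2 : 2 ≤ n := by
    by_contra! hlt
    interval_cases n
    · simp at hij
    · have := ones_succ w i
      have := ones_succ w j
      have := hle1 i
      have := hge0 j
      omega
  obtain ⟨m, rfl⟩ : ∃ m, n = m + 2 := ⟨n - 2, by omega⟩
  -- the height difference of the two prefixes of length `k` is `1` for `0 < k < m + 2`
  have hd : ∀ k, k ≤ m →
      w.ones (i + 1 + k) - w.ones i = w.ones (j + 1 + k) - w.ones j + 1 := by
    -- By minimality the prefix and the remaining suffix each contribute at most 1 to a total excess
    -- of at least 2.
    intro k hk
    have h1 := hmin (k + 1) (by omega) i j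
    have h2 := hmin (m + 1 - k) (by omega) (i + 1 + k) (j + 1 + k)
    rw [show i + 1 + k + (m + 1 - k) = i + (m + 2) by omega,
      show j + 1 + k + (m + 1 - k) = j + (m + 2) by omega] at h2
    rw [show i + (k + 1) = i + 1 + k by ring, show j + (k + 1) = j + 1 + k by ring] at h1
    omega
  have hi0 := hd 0 (by omega)
  have him := hd m le_rfl
  simp only [add_zero, ones_succ] at hi0
  have hwi : w i = 1 := by have := hle1 i; have := hge0 j; omega
  have hwj : w j = 0 := by have := hle1 i; have := hge0 j; omega
  have hli := ones_succ w (i + 1 + m)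
  have hlj := ones_succ w (j + 1 + m)
  rw [show i + 1 + m + 1 = i + (m + 2) by ring] at hli
  rw [show j + 1 + m + 1 = j + (m + 2) by ring] at hlj
  have hwi' : w (i + 1 + m) = 1 := by
    have := hle1 (i + 1 + m); have := hge0 (j + 1 + m); omega
  have hwj' : w (j + 1 + m) = 0 := by
    have := hle1 (i + 1 + m); have := hge0 (j + 1 + m); omega
  have hagree : w.AgreeAt (i + 1) (j + 1) m := by
    intro k hk
    have h1 := hd k hk.le
    have h2 := hd (k + 1) hk
    rw [← add_assoc, ← add_assoc, ones_succ, ones_succ] at h2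
    omega
  -- prefixes and suffixes of the common middle factor have the same height
  have hps : ∀ k ≤ m, w.ones (i + 1 + k) - w.ones (i + 1) =
      w.ones (i + 1 + m) - w.ones (i + 1 + m - k) := by
    intro k hk
    have h1 := hmin (k + 1) (by omega) i (j + 1 + m - k)
    have h2 := hmin (k + 1) (by omega) (i + 1 + m - k) j
    have h3 := hd (m - k) (by omega)
    have h4 := hd k hk
    rw [show j + 1 + (m - k) = j + 1 + m - k by omega,
      show i + 1 + (m - k) = i + 1 + m - k by omega] at h3
    rw [show i + (k + 1) = i + 1 + k by ring,
      show j + 1 + m - k + (k + 1) = j + (m + 2) by omega] at h1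
    rw [show j + (k + 1) = j + 1 + k by ring,
      show i + 1 + m - k + (k + 1) = i + (m + 2) by omega] at h2
    have h5 := ones_succ w i
    rw [hwi] at h5
    rw [hwi'] at hli
    rw [hwj'] at hlj
    simp only [Fin.val_one, Fin.val_zero, Nat.cast_one, Nat.cast_zero] at h5 hli hlj
    omega
  have hpal : ∀ k < m, w (i + 1 + k) = w (i + (m - k)) := by
    intro k hk
    have h1 := hps k hk.le
    have h2 := hps (k + 1) hk
    have h3 := ones_succ w (i + 1 + m - (k + 1))
    rw [show i + 1 + m - (k + 1) + 1 = i + 1 + m - k by omega] at h3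
    rw [← add_assoc, ones_succ] at h2
    rw [show i + 1 + m - (k + 1) = i + (m - k) by omega] at h2 h3
    omega
  have hsp : w.IsRightSpecialAt (i + 1) m := ⟨j + 1, hagree, by rw [hwi', hwj']; decide⟩
  obtain ⟨s, hs⟩ := hw.exists_isRightSpecialAt (m + 1)
  have hsi := hw.agreeAt_of_isRightSpecialAt hs.tail hsp
  by_cases hws : w s = 0
  · refine hw.false_of_palindrome_of_ne hs hsi hpal ?_ (by rw [hws, hwi]; decide)
    rw [show i + m + 1 = i + 1 + m by ring, hwi', hwi]
  · refine hw.false_of_palindrome_of_ne hs (hsi.trans hagree) (fun k hk => ?_) ?_ (by rwa [hwj])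
    · rw [← hagree k hk, hpal k hk]
      have := hagree (m - k - 1) (by omega)
      rwa [show i + 1 + (m - k - 1) = i + (m - k) by omega,
        show j + 1 + (m - k - 1) = j + (m - k) by omega] at this
    · rw [show j + m + 1 = j + 1 + m by ring, hwj', hwj]

/-! ### Two balanced words with recurrently equal heights -/

theorem ones_add_mul_le {w : InfWord} {M : ℕ} {g : ℤ}
    (h : ∀ i, w.ones (i + M) - w.ones i ≤ g) (i k : ℕ) :
    w.ones (i + k * M) - w.ones i ≤ k * g := by
  induction k with
  | zero => simp
  | succ k ih =>
    have := h (i + k * M)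
    rw [show i + (k + 1) * M = i + k * M + M by ring]
    push_cast
    linarith

theorem le_ones_add_mul {w : InfWord} {M : ℕ} {g : ℤ}
    (h : ∀ i, g ≤ w.ones (i + M) - w.ones i) (i k : ℕ) :
    k * g ≤ w.ones (i + k * M) - w.ones i := by
  induction k with
  | zero => simp
  | succ k ih =>
    have := h (i + k * M)
    rw [show i + (k + 1) * M = i + k * M + M by ring]
    push_cast
    linarith

theorem ones_add_le (w : InfWord) (n r : ℕ) : w.ones (n + r) ≤ w.ones n + r := by
  induction r with
  | zero => simp
  | succ r ih =>
    rw [← add_assoc, ones_succ]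
    push_cast
    omega

theorem le_ones_add (w : InfWord) (n r : ℕ) : w.ones n ≤ w.ones (n + r) := by
  induction r with
  | zero => simp
  | succ r ih =>
    rw [← add_assoc, ones_succ]
    omega

/-- Two words whose prefixes have the same height for arbitrarily large lengths cannot have
windows of a length `M` separated by a gap. -/
theorem not_ones_lt_of_frequently_eq {w w' : InfWord} (hc : ∀ N, ∃ c ≥ N, w.ones c = w'.ones c)
    {M : ℕ} (hM : 0 < M) {g : ℤ} (h : ∀ i, w.ones (i + M) - w.ones i ≤ g - 1)
    (h' : ∀ i, g ≤ w'.ones (i + M) - w'.ones i) : False := by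
  obtain ⟨c, hcN, hcc⟩ := hc ((M + 1) * M)
  have h1 := ones_add_mul_le h 0 (c / M)
  have h2 := le_ones_add_mul h' 0 (c / M)
  have h3 := w.ones_add_le (c / M * M) (c % M)
  have h4 := w'.le_ones_add (c / M * M) (c % M)
  -- The gap grows by 1 per window; more than `M` windows outweigh the remainder `c % M`.
  have h5 : M + 1 ≤ c / M := (Nat.le_div_iff_mul_le hM).2 hcN
  have h6 := Nat.mod_lt c hM
  rw [Nat.div_add_mod'] at h3 h4
  simp only [zero_add, ones_zero, sub_zero] at h1 h2
  rw [mul_sub] at h1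
  omega

/-- By balance, `L`-windows have at most `g` ones in `w` and at least `g` in `w'`. Only finitely
many windows of `w` fall short of `g`, and once the count is constant, sliding the window by one
letter gives period `L`. -/
theorem IsBalanced.isEventuallyPeriodic {w w' : InfWord} (hw : w.IsBalanced) (hw' : w'.IsBalanced)
    (hc : ∀ N, ∃ c ≥ N, w.ones c = w'.ones c) {a b L : ℕ}
    (h : w'.ones (b + L) - w'.ones b = w.ones (a + L) - w.ones a + 2) :
    w.IsEventuallyPeriodic := by
  have hL : 0 < L := by
    rcases Nat.eq_zero_or_pos L with rfl | hL
    · simp at h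
    · exact hL
  set g := w.ones (a + L) - w.ones a + 1 with hg
  have hle : ∀ i, w.ones (i + L) - w.ones i ≤ g := fun i => hw i a L
  have hge : ∀ i, g ≤ w'.ones (i + L) - w'.ones i := fun i => by
    have := hw' b i L
    omega
  -- Two deficient windows a multiple of `L` apart bound a window with at most `(t + 2) * g - 2`
  -- ones; balance then keeps every window of that length in `w` strictly below those of `w'`.
  have hlt : ∀ i t, w.ones (i + L) - w.ones i < g →
      ¬ w.ones (i + (t + 1) * L + L) - w.ones (i + (t + 1) * L) < g := by
    intro i t h1 h2
    refine not_ones_lt_of_frequently_eq hc (M := (t + 2) * L) (by positivity)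
      (g := ((t + 2 : ℕ) : ℤ) * g) (fun k => ?_) (fun k => le_ones_add_mul hge k _)
    have h3 := hw k i ((t + 2) * L)
    have h4 := ones_add_mul_le hle (i + L) t
    rw [show i + L + t * L = i + (t + 1) * L by ring] at h4
    rw [show i + (t + 2) * L = i + (t + 1) * L + L by ring] at h3
    push_cast
    linarith
  have hinj : Set.InjOn (fun i => i % L) {i | w.ones (i + L) - w.ones i < g} := by
    have aux : ∀ i j, i < j → i % L = j % L → w.ones (i + L) - w.ones i < g →
        w.ones (j + L) - w.ones j < g → False := by
      intro i j hij hmod hi hj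
      obtain ⟨t, ht⟩ := (Nat.modEq_iff_dvd' hij.le).1 hmod
      obtain ⟨t, rfl⟩ : ∃ u, t = u + 1 :=
        Nat.exists_eq_succ_of_ne_zero (by rintro rfl; omega)
      refine hlt i t hi ?_
      rwa [show i + (t + 1) * L = j by rw [mul_comm]; omega]
    intro i hi j hj hij
    rcases lt_trichotomy i j with hlt | heq | hgt
    exacts [(aux i j hlt hij hi hj).elim, heq, (aux j i hgt hij.symm hj hi).elim]
  have hfin : {i | w.ones (i + L) - w.ones i < g}.Finite := by
    refine Set.Finite.of_finite_image ((Set.finite_lt_nat L).subset ?_) hinj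
    rintro _ ⟨i, -, rfl⟩
    exact Nat.mod_lt i hL
  obtain ⟨B, hB⟩ := hfin.bddAbove
  have heq : ∀ i, B < i → w.ones (i + L) - w.ones i = g := by
    intro i hi
    by_contra hne
    exact absurd (hB (lt_of_le_of_ne (hle i) hne)) (by omega)
  refine ⟨B + 1, L, hL, fun i hi => ?_⟩
  have h1 := heq i (by omega)
  have h2 := heq (i + 1) (by omega)
  rw [show i + 1 + L = i + L + 1 by ring, ones_succ, ones_succ] at h2
  omega

/-! ### Block boundaries and reversal -/

theorem IsProduct.succ {w : InfWord} {x : ℕ → FinWord} (h : w.IsProduct x) (n : ℕ) :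
    (x n).head? = some (w ((List.range n).map x).flatten.length) := by
  have h1 := h.2 (n + 1)
  set p := ((List.range n).map x).flatten with hp
  have h2 : ((List.range (n + 1)).map x).flatten = p ++ x n := by
    rw [hp, List.range_succ]
    simp
  rw [h2] at h1
  have h3 := congrArg (fun l => l[p.length]?) h1
  have h4 : 0 < (x n).length := List.length_pos_iff.2 (h.1 n)
  simpa [factorAt, List.head?_eq_getElem?, h4] using h3

theorem sum_val_factorAt (w : InfWord) (n : ℕ) :
    ((w.factorAt 0 n).map fun a => (a.val : ℤ)).sum = w.ones n := by
  induction n with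
  | zero => simp [factorAt, ones]
  | succ n ih =>
    rw [ones_succ, ← ih]
    simp [factorAt, List.range_succ]

theorem IsProduct.ones_eq {w : InfWord} {x : ℕ → FinWord} (h : w.IsProduct x) (n : ℕ) :
    w.ones ((List.range n).map x).flatten.length =
      (((List.range n).map x).flatten.map fun a => (a.val : ℤ)).sum := by
  rw [← sum_val_factorAt, ← h.2 n]

theorem IsProduct.le_length {w : InfWord} {x : ℕ → FinWord} (h : w.IsProduct x) (n : ℕ) :
    n ≤ ((List.range n).map x).flatten.length := by
  induction n with
  | zero => simp
  | succ n ih =>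
    have := List.length_pos_iff.2 (h.1 n)
    rw [List.range_succ, List.map_append, List.flatten_append, List.length_append]
    simp only [List.map_cons, List.map_nil, List.flatten_cons, List.flatten_nil, List.append_nil]
    omega

theorem length_flatten_reverse (x : ℕ → FinWord) (n : ℕ) :
    ((List.range n).map fun k => (x k).reverse).flatten.length =
      ((List.range n).map x).flatten.length := by
  induction n with
  | zero => simp
  | succ n ih => simp only [List.range_succ, List.map_append, List.flatten_append,
      List.length_append, ih]; simp

theorem sum_flatten_reverse (x : ℕ → FinWord) (n : ℕ) :
    (((List.range n).map fun k => (x k).reverse).flatten.map fun a => (a.val : ℤ)).sum =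
      (((List.range n).map x).flatten.map fun a => (a.val : ℤ)).sum := by
  induction n with
  | zero => simp
  | succ n ih => simp only [List.range_succ, List.map_append, List.flatten_append,
      List.sum_append, ih]; simp

/-! ### First and last letters of Christoffel words -/

theorem IsOmegaPower.length_pos {w : InfWord} {v : FinWord} (h : w.IsOmegaPower v) :
    0 < v.length := by
  rw [List.length_pos_iff]
  rintro rfl
  simpa using h 0

/-- The letter of a purely periodic word that precedes a multiple of the period. -/
theorem IsOmegaPower.getLast?_eq {w : InfWord} {v : FinWord} (h : w.IsOmegaPower v) {q : ℕ}
    (hq : 0 < q) : v.getLast? = some (w (q * v.length - 1)) := by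
  have hv := h.length_pos
  rw [← h, List.getLast?_eq_getElem?]
  congr 1
  obtain ⟨q, rfl⟩ := Nat.exists_eq_succ_of_ne_zero hq.ne'
  rw [show (q + 1) * v.length - 1 = v.length - 1 + v.length * q by
    rw [add_mul, mul_comm q]; omega, Nat.add_mul_mod_self_left, Nat.mod_eq_of_lt (by omega)]

theorem IsOmegaPower.head?_eq {w : InfWord} {v : FinWord} (h : w.IsOmegaPower v) :
    v.head? = some (w 0) := by
  rw [← h 0, List.head?_eq_getElem?, Nat.zero_mod]

end InfWord

namespace FinWord

open InfWord

/-- With `l` the length of `v`, the index ends a copy of `v` and is `-1` modulo the denominator, so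
the last letter of `v` is found without computing `l`. -/
theorem fract_den_mul_sub_one {α : ℚ} (h0 : 0 < α) (h1 : α < 1) {l : ℕ} (hl : 0 < l) :
    Int.fract (((α.den * l - 1 : ℕ) : ℝ) * (α : ℝ) + 0) = 1 - (α : ℝ) := by
  have hpos : 1 ≤ α.den * l := Nat.mul_pos α.den_pos hl
  have hα : (α.den : ℝ) * (α : ℝ) = (α.num : ℝ) := by
    exact_mod_cast (mul_comm _ _).trans (Rat.mul_den_eq_num α)
  have h0' : (0 : ℝ) < α := by exact_mod_cast h0
  have h1' : (α : ℝ) < 1 := by exact_mod_cast h1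
  rw [Int.fract_eq_iff]
  refine ⟨by linarith, by linarith, l * α.num - 1, ?_⟩
  push_cast [Nat.cast_sub hpos]
  linear_combination (l : ℝ) * hα

theorem IsLowerChristoffel.head?_getLast? {v : FinWord} (h : v.IsLowerChristoffel)
    (h' : ¬ v.IsUpperChristoffel) : v.head? = some 0 ∧ v.getLast? = some 1 := by
  rcases h with h | ⟨α, h0, h1, hv, -⟩
  · exact (h' (Or.inl h)).elim
  refine ⟨?_, ?_⟩
  · have h1' : (α : ℝ) < 1 := by exact_mod_cast h1
    simp [hv.head?_eq, lowerMechanical, h1']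
  · rw [hv.getLast?_eq α.den_pos, lowerMechanical, fract_den_mul_sub_one h0 h1 hv.length_pos]
    simp

theorem IsUpperChristoffel.head?_getLast? {v : FinWord} (h : v.IsUpperChristoffel)
    (h' : ¬ v.IsLowerChristoffel) : v.head? = some 1 ∧ v.getLast? = some 0 := by
  rcases h with h | ⟨α, h0, h1, hv, -⟩
  · exact (h' (Or.inl h)).elim
  refine ⟨?_, ?_⟩
  · simp [hv.head?_eq, upperMechanical]
  · have h1' : (α : ℝ) < 1 := by exact_mod_cast h1
    rw [hv.getLast?_eq α.den_pos, upperMechanical, fract_den_mul_sub_one h0 h1 hv.length_pos]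
    simp [h1']

end FinWord

theorem mainTheorem7 (w : InfWord) (hw : w.IsSturmian) (x : ℕ → FinWord)
    (hx : w.IsRCFactorization x) :
    (∀ k : ℕ, FinWord.IsUpperChristoffel (x k)) ∨
      (∀ k : ℕ, FinWord.IsLowerChristoffel (x k)) := by
  obtain ⟨hC, hP, w', hP', hw'⟩ := hx
  by_contra! hno
  obtain ⟨⟨k, hk⟩, l, hl⟩ := hno
  have hk' := ((hC k).resolve_right hk).head?_getLast? hk
  have hl' := ((hC l).resolve_left hl).head?_getLast? hl
  set c : ℕ → ℕ := fun n => ((List.range n).map x).flatten.length with hc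
  have heq : ∀ n, w.ones (c n) = w'.ones (c n) := fun n => by
    rw [hc]
    dsimp only
    rw [hP.ones_eq, ← InfWord.sum_flatten_reverse, ← hP'.ones_eq, InfWord.length_flatten_reverse]
  have hfreq : ∀ N, ∃ n ≥ N, w.ones n = w'.ones n := fun N => ⟨c N, hP.le_length N, heq N⟩
  have hhead : ∀ n, (x n).head? = some (w (c n)) := hP.succ
  -- The reversed block starts with the last letter of `x n`.
  have hlast : ∀ n, (x n).getLast? = some (w' (c n)) := fun n => by
    have := hP'.succ n
    rwa [InfWord.length_flatten_reverse, List.head?_reverse] at this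
  have h1 : w'.ones (c k + 1) = w.ones (c k + 1) + 1 := by
    have e0 : w (c k) = 0 := Option.some.inj ((hhead k).symm.trans hk'.1)
    have e1 : w' (c k) = 1 := Option.some.inj ((hlast k).symm.trans hk'.2)
    simp [InfWord.ones_succ, heq, e0, e1]
  have h2 : w.ones (c l + 1) = w'.ones (c l + 1) + 1 := by
    have e0 : w (c l) = 1 := Option.some.inj ((hhead l).symm.trans hl'.1)
    have e1 : w' (c l) = 0 := Option.some.inj ((hlast l).symm.trans hl'.2)
    simp [InfWord.ones_succ, heq, e0, e1]
  generalize c k + 1 = m at h1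
  generalize c l + 1 = n at h2
  -- Between `m` and `n` the height difference changes by 2; their order decides which word has the
  -- richer window.
  rcases Nat.le_total m n with hmn | hmn
  · obtain ⟨L, rfl⟩ := Nat.exists_eq_add_of_le hmn
    exact hw'.not_isEventuallyPeriodic (hw'.isBalanced.isEventuallyPeriodic hw.isBalanced
      (fun N => (hfreq N).imp fun _ h => ⟨h.1, h.2.symm⟩) (a := m) (b := m) (L := L) (by omega))
  · obtain ⟨L, rfl⟩ := Nat.exists_eq_add_of_le hmn
    exact hw.not_isEventuallyPeriodic (hw.isBalanced.isEventuallyPeriodic hw'.isBalanced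
      hfreq (a := n) (b := n) (L := L) (by omega))
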